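/- A market of size $n$ consists of $n$ firms and $n$ workers; every agent has a strict preference order over the agents of the other side and being single, and prefers every agent of the other side to being single. A pair (firm, worker) blocks a matching if the two are not matched with each other but each prefers the other to the current situation; a matching is stable if no pair blocks it. A blocking pair is a best blocking pair if one of its two agents prefers the partner in this pair to every other partner with whom this agent could form a blocking pair. Satisfying a blocking pair means matching its two agents with each other, leaving their former partners (if any) single, and keeping all other matches. Let $\kappa\ge 1$. In $\kappa$-random dynamics (respectively, $\kappa$-random best dynamics), at each step, as long as the current matching is unstable, one randomly chosen blocking pair (respectively, best blocking pair) of the current matching is satisfied, where the probabilities may depend on time and on the past, but any such pair is at most $\kappa$ times as likely to be chosen as any other one; the process stops at a stable matching. Let $\delta>0$. A $\delta$-augmented market of a market of size $n$ with a unique stable matching is a market obtained by adding $k\le\delta n$ new firms and $k$ new workers, such that (i) the two markets coincide when restricted to the original agents; (ii) the augmented market has a unique stable matching; (iii) every original agent has the same stable partner in both markets. In a market with a unique stable matching, a matching is $\varepsilon$-unstable if at least an $\varepsilon$-fraction of the firms are not matched with their stable partners. **Theorem.** Let $(M_n)_{n\in\mathbb N}$ be any sequence of markets, $M_n$ of size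 $n$ with a unique stable matching, and let $\delta>0$, $\varepsilon\in(0,1]$ and $\kappa\ge 1$. Then there are $\delta$-augmented markets $A_n$ of $M_n$, $n\in\mathbb N$, and a constant $c>0$ such that for all sufficiently large $n$, for every $\varepsilon$-unstable matching $\lambda$ of $A_n$ and for all $\kappa$-random dynamics and all $\kappa$-random best dynamics on $A_n$ started at $\lambda$, the number of steps until a stable matching is reached is at least $2^{cn}$ with probability at least $1-2^{-cn}$. -/

import Mathlib

/-- A two-sided matching market with firms `F` and workers `W`. Each agent has a strict
preference (a strict total order) over the agents of the other side and being single, and all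
pairs are mutually acceptable. The option `none` stands for being single, and
`M.firmPref f x y` says that firm `f` strictly prefers `x` to `y`. -/
structure Market (F W : Type*) where
  firmPref : F → Option W → Option W → Prop
  workerPref : W → Option F → Option F → Prop
  firmPref_strictTotal : ∀ f, IsStrictTotalOrder (Option W) (firmPref f)
  workerPref_strictTotal : ∀ w, IsStrictTotalOrder (Option F) (workerPref w)
  firm_acceptable : ∀ f w, firmPref f (some w) none
  worker_acceptable : ∀ w f, workerPref w (some f) none

/-- A matching is a partial bijection between firms and workers: `μ f` is the worker matched with
firm `f`, `μ.symm w` is the firm matched with worker `w`, and `none` means being single. -/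
abbrev Matching (F W : Type*) := F ≃. W

/-- The matching obtained from `μ` by satisfying the pair `(f, w)`: the two are matched with each
other, their partners at `μ`, if any, become single, and all other agents keep their match. -/
def Matching.satisfy {F W : Type*} [DecidableEq F] [DecidableEq W]
    (μ : Matching F W) (f : F) (w : W) : Matching F W where
  toFun f' := if f' = f then some w else if μ f' = some w then none else μ f'
  invFun w' := if w' = w then some f else if μ.symm w' = some f then none else μ.symm w'
  inv f' w' := by
    have h (a : F) (b : W) : μ.symm b = some a ↔ μ a = some b := μ.inv a b
    have h' (a a' : F) (b : W) (ha : μ a = some b) (ha' : μ a' = some b) : a = a' := μ.inj ha ha'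
    grind

namespace Market

variable {F W : Type*}

/-- `(f, w)` is a blocking pair of `μ`. -/
def IsBlocking (M : Market F W) (μ : Matching F W) (f : F) (w : W) : Prop :=
  μ f ≠ some w ∧ M.firmPref f (some w) (μ f) ∧ M.workerPref w (some f) (μ.symm w)

/-- A matching is stable if it has no blocking pairs. -/
def IsStable (M : Market F W) (μ : Matching F W) : Prop :=
  ∀ f w, ¬ M.IsBlocking μ f w

/-- `(f, w)` is a best blocking pair of `μ`: a blocking pair that is best for (at least) one of its
two agents, who prefers the partner in this pair to any other partner with whom this agent could
form a blocking pair. -/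
def IsBestBlocking (M : Market F W) (μ : Matching F W) (f : F) (w : W) : Prop :=
  M.IsBlocking μ f w ∧
    ((∀ w', M.IsBlocking μ f w' → w' ≠ w → M.firmPref f (some w) (some w')) ∨
      (∀ f', M.IsBlocking μ f' w → f' ≠ f → M.workerPref w (some f) (some f')))

/-- `(X t)` is a random decentralized process on the probability space `(Ω, P)`, started at `lam`:
as long as the current matching is unstable, one of the pairs of the current matching that are
admissible according to `B` is satisfied, and, given the current matching at any step, an admissible
pair is at most `κ` times as likely to be satisfied as any other; a stable matching is never
left. Here `B` is to be the blocking pairs or the best blocking pairs. The probabilities of the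
pairs may depend on time, and a process that chooses them depending on its whole history
also satisfies the condition, since the ratio bound is inherited by averages over histories.
(Distinct pairs lead to distinct matchings, and there are finitely many matchings, so that
`measurable` is measurability for the discrete σ-algebra.) -/
structure IsKappaRandom [DecidableEq F] [DecidableEq W] (M : Market F W)
    (B : Matching F W → F → W → Prop) (κ : ℝ) (lam : Matching F W)
    {Ω : Type*} [MeasurableSpace Ω] (P : MeasureTheory.Measure Ω)
    (X : ℕ → Ω → Matching F W) : Prop where
  measurable : ∀ t μ, MeasurableSet {ω | X t ω = μ}
  start : ∀ᵐ ω ∂P, X 0 ω = lam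
  step_unstable : ∀ t, ∀ᵐ ω ∂P, ¬ M.IsStable (X t ω) →
    ∃ f w, B (X t ω) f w ∧ X (t + 1) ω = (X t ω).satisfy f w
  step_stable : ∀ t, ∀ᵐ ω ∂P, M.IsStable (X t ω) → X (t + 1) ω = X t ω
  ratio : ∀ t μ f w f' w', B μ f w → B μ f' w' →
    P {ω | X t ω = μ ∧ X (t + 1) ω = μ.satisfy f w} ≤
      ENNReal.ofReal κ * P {ω | X t ω = μ ∧ X (t + 1) ω = μ.satisfy f' w'}

/-- `κ`-random dynamics: blocking pairs are satisfied. -/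
def IsRandomDynamics [DecidableEq F] [DecidableEq W] (M : Market F W) (κ : ℝ) (lam : Matching F W)
    {Ω : Type*} [MeasurableSpace Ω] (P : MeasureTheory.Measure Ω)
    (X : ℕ → Ω → Matching F W) : Prop :=
  M.IsKappaRandom M.IsBlocking κ lam P X

/-- `κ`-random best dynamics: best blocking pairs are satisfied. -/
def IsRandomBestDynamics [DecidableEq F] [DecidableEq W] (M : Market F W) (κ : ℝ)
    (lam : Matching F W) {Ω : Type*} [MeasurableSpace Ω] (P : MeasureTheory.Measure Ω)
    (X : ℕ → Ω → Matching F W) : Prop :=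
  M.IsKappaRandom M.IsBestBlocking κ lam P X

/-- In a market with a unique stable matching, `lam` is `ε`-unstable if at least an `ε`-fraction of
the firms are not matched with their stable partners. -/
def IsEpsUnstable [Fintype F] (M : Market F W) (ε : ℝ) (lam : Matching F W) : Prop :=
  ∃ μ, M.IsStable μ ∧ ε * Fintype.card F ≤ ({f | lam f ≠ μ f} : Set F).ncard

/-- `M'` is a `δ`-augmented market of `M` (a market with a unique stable matching), with new firms
`F'` and new workers `W'`. -/
structure IsAugmentation [Fintype F] [Fintype W] {F' W' : Type*} [Fintype F'] [Fintype W']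
    (δ : ℝ) (M : Market F W) (M' : Market (F ⊕ F') (W ⊕ W')) : Prop where
  card_firms : (Fintype.card F' : ℝ) ≤ δ * Fintype.card F
  card_workers : (Fintype.card W' : ℝ) ≤ δ * Fintype.card W
  firmPref_iff : ∀ f x y,
    M'.firmPref (Sum.inl f) (x.map Sum.inl) (y.map Sum.inl) ↔ M.firmPref f x y
  workerPref_iff : ∀ w x y,
    M'.workerPref (Sum.inl w) (x.map Sum.inl) (y.map Sum.inl) ↔ M.workerPref w x y
  unique_stable : ∃! μ', M'.IsStable μ'
  firm_partner : ∀ μ μ', M.IsStable μ → M'.IsStable μ' →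
    ∀ f, μ' (Sum.inl f) = (μ f).map Sum.inl
  worker_partner : ∀ μ μ', M.IsStable μ → M'.IsStable μ' →
    ∀ w, μ'.symm (Sum.inl w) = (μ.symm w).map Sum.inl

end Market

/-! The unique stable matching extends to a stable matching `e` of the augmented market such that
every agent outside one pair `(z, e z)` is preferred by linearly many agents of the other side to
their partners at `e` (`exists_le_card_augPref`). Near `e`, a single agent outside this pair thus
creates linearly many best blocking pairs whose satisfaction breaks pairs of `e`, while a blocking
pair reduces the distance from `e` only if it re-forms one of the few lost pairs. So the distance
drifts upwards while it is small. The exceptional pair forces uniqueness of the stable matching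
(`IsSink.existsUnique_isStable`).

The drift may fail at matchings where nobody outside `(z, e z)` is single. At most three of these
occur in a row (`level_satisfy_lt`), and at most nine steps lead to one. The potential `weight`,
which is `2 ^ (-distance) * 4 ^ level`, absorbs them: with `N` a small multiple of `n`, its
expectation grows by at most `64 * (1 / 2) ^ N` per step (`IsAttractive.sum_mul_weight_le`). It is
tiny at the start and at least 1 at `e`, so the process is at `e` at time `t` with probability at
most `64 * (t + 1) * (1 / 2) ^ N`. Stable matchings are absorbing, so this controls the hitting
time.

Only best blocking pairs are counted as helpful, while all blocking pairs are allowed as harmful;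
this covers both dynamics at once. -/

namespace Market

variable {F W : Type*}

/-! ### Preferences, exchange of sides, perfectness of stable matchings. -/

lemma firmPref_irrefl (M : Market F W) (f : F) (x : Option W) : ¬ M.firmPref f x x :=
  have := M.firmPref_strictTotal f
  irrefl_of (M.firmPref f) x

lemma firmPref_trans (M : Market F W) {f : F} {x y z : Option W}
    (hxy : M.firmPref f x y) (hyz : M.firmPref f y z) : M.firmPref f x z :=
  have := M.firmPref_strictTotal f
  trans_of (M.firmPref f) hxy hyz

lemma firmPref_or_of_ne (M : Market F W) (f : F) {x y : Option W} (h : x ≠ y) :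
    M.firmPref f x y ∨ M.firmPref f y x := by
  have := M.firmPref_strictTotal f
  rcases trichotomous_of (M.firmPref f) x y with h' | h' | h'
  · exact .inl h'
  · exact absurd h' h
  · exact .inr h'

lemma workerPref_irrefl (M : Market F W) (w : W) (x : Option F) : ¬ M.workerPref w x x :=
  have := M.workerPref_strictTotal w
  irrefl_of (M.workerPref w) x

lemma workerPref_trans (M : Market F W) {w : W} {x y z : Option F}
    (hxy : M.workerPref w x y) (hyz : M.workerPref w y z) : M.workerPref w x z :=
  have := M.workerPref_strictTotal w
  trans_of (M.workerPref w) hxy hyz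

lemma workerPref_or_of_ne (M : Market F W) (w : W) {x y : Option F} (h : x ≠ y) :
    M.workerPref w x y ∨ M.workerPref w y x := by
  have := M.workerPref_strictTotal w
  rcases trichotomous_of (M.workerPref w) x y with h' | h' | h'
  · exact .inl h'
  · exact absurd h' h
  · exact .inr h'

/-- The market with the roles of firms and workers exchanged. -/
def swap (M : Market F W) : Market W F where
  firmPref := M.workerPref
  workerPref := M.firmPref
  firmPref_strictTotal := M.workerPref_strictTotal
  workerPref_strictTotal := M.firmPref_strictTotal
  firm_acceptable := M.worker_acceptable
  worker_acceptable := M.firm_acceptable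

lemma isBlocking_swap {M : Market F W} {μ : Matching F W} {f : F} {w : W} :
    M.swap.IsBlocking μ.symm w f ↔ M.IsBlocking μ f w := by
  unfold IsBlocking swap
  rw [Ne, PEquiv.eq_some_iff, PEquiv.symm_symm]
  tauto

lemma isBestBlocking_swap {M : Market F W} {μ : Matching F W} {f : F} {w : W} :
    M.swap.IsBestBlocking μ.symm w f ↔ M.IsBestBlocking μ f w := by
  unfold IsBestBlocking
  simp only [isBlocking_swap]
  exact and_congr_right fun _ => or_comm

lemma isStable_swap {M : Market F W} {μ : Matching F W} :
    M.swap.IsStable μ.symm ↔ M.IsStable μ := by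
  unfold IsStable
  simp only [isBlocking_swap]
  exact forall_comm

/-- In a balanced market, if all workers are matched then so are all firms. -/
lemma _root_.Matching.forall_firm_ne_none [Finite F] (e : F ≃ W) {μ : Matching F W}
    (h : ∀ w, μ.symm w ≠ none) (f : F) : μ f ≠ none := by
  choose g hg using fun w => Option.ne_none_iff_exists'.1 (h w)
  have hinj : Function.Injective (g ∘ e) := fun a b hab =>
    e.injective (μ.symm.inj (b := g (e a)) (hg _)
      (by rw [hg, Option.mem_def]; exact congrArg some hab.symm))
  obtain ⟨a, ha⟩ := (Finite.injective_iff_surjective.1 hinj) f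
  have := hg (e a)
  rw [PEquiv.eq_some_iff] at this
  rw [← ha, Function.comp, this]
  simp

lemma _root_.Matching.forall_worker_ne_none [Finite F] (e : F ≃ W) {μ : Matching F W}
    (h : ∀ f, μ f ≠ none) (w : W) : μ.symm w ≠ none :=
  have : Finite W := .of_equiv F e
  Matching.forall_firm_ne_none e.symm (μ := μ.symm) h w

/-- The stable matchings of a balanced market are perfect. -/
lemma IsStable.exists_eq_toPEquiv [Finite F] (e : F ≃ W) {M : Market F W} {μ : Matching F W}
    (hμ : M.IsStable μ) : ∃ g : F ≃ W, μ = g.toPEquiv := by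
  have hf : ∀ f, μ f ≠ none := by
    intro f hf
    have : ∃ w, μ.symm w = none := by
      by_contra! h
      exact Matching.forall_firm_ne_none e h f hf
    obtain ⟨w, hw⟩ := this
    exact hμ f w ⟨by simp [hf], hf ▸ M.firm_acceptable f w, hw ▸ M.worker_acceptable w f⟩
  have hw := Matching.forall_worker_ne_none e hf
  choose g hg using fun f => Option.ne_none_iff_exists'.1 (hf f)
  choose g' hg' using fun w => Option.ne_none_iff_exists'.1 (hw w)
  refine ⟨⟨g, g', fun f => ?_, fun w => ?_⟩, PEquiv.ext fun f => by simp [hg]⟩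
  · have := (μ.eq_some_iff).2 (hg f)
    rw [hg'] at this
    exact Option.some.inj this
  · have := (μ.eq_some_iff).1 (hg' w)
    rw [hg] at this
    exact Option.some.inj this

@[simp] lemma _root_.Equiv.toPEquiv_symm_apply (e : F ≃ W) (w : W) :
    e.toPEquiv.symm w = some (e.symm w) := by
  rw [← Equiv.toPEquiv_symm, Equiv.toPEquiv_apply]

/-! ### Uniqueness of the stable matching from a two-sided sink. -/

/-- With respect to the matching `e`, the pair `(z, e z)` is a firm-side sink: `z` is never worse off
when matched, and `e z` is the next best partner, after the stable one, of every other firm. -/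
structure IsSink (A : Market F W) (e : F ≃ W) (z : F) : Prop where
  pref_of_ne : ∀ w, w ≠ e z → A.firmPref z (some w) (some (e z))
  next_best : ∀ f, f ≠ z → ∀ w, A.firmPref f (some (e f)) (some w) → w ≠ e z →
    A.firmPref f (some (e z)) (some w)

/-- By stability of both matchings, the set `S` of firms that prefer `e` has the same partners at
`e` and at `g`, and `z ∉ S`. A firm `f ∈ S` therefore gets at `g` something worse than `e z`. As
`(f, e z)` does not block `g`, the worker `e z` has there a firm `f₀` that it prefers to `f`, hence
to `z`. But `f₀ ∉ S`, so `(f₀, e z)` blocks `e`. -/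
lemma IsSink.not_firmPref [Finite F] {A : Market F W} {e g : F ≃ W} {z : F}
    (he : A.IsStable e.toPEquiv) (hg : A.IsStable g.toPEquiv)
    (hz : A.IsSink e z) (hz' : A.swap.IsSink e.symm (e z)) (f : F) :
    ¬ A.firmPref f (some (e f)) (some (g f)) := by
  simp only [IsStable, IsBlocking, Equiv.toPEquiv_apply, Equiv.toPEquiv_symm_apply, ne_eq,
    Option.some.injEq, not_and] at he hg
  intro hf
  set S : Set F := {f | A.firmPref f (some (e f)) (some (g f))} with hS
  have hzS : z ∉ S := by
    intro h
    have hne : g z ≠ e z := fun h' => A.firmPref_irrefl z (some (e z)) (by simpa [hS, h'] using h)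
    exact A.firmPref_irrefl _ _ (A.firmPref_trans h (hz.pref_of_ne _ hne))
  have hmaps : ∀ x ∈ S, g.symm (e x) ∈ S := by
    intro x hx
    have hne : g x ≠ e x := fun h => A.firmPref_irrefl x (some (e x)) (by simpa [hS, h] using hx)
    have h1 := hg x (e x) hne hx
    have hne' : g.symm (e x) ≠ x := fun h => hne (by rw [Equiv.symm_apply_eq] at h; exact h.symm)
    have h2 : A.workerPref (e x) (some (g.symm (e x))) (some x) :=
      (A.workerPref_or_of_ne _ (by simpa using hne')).resolve_right h1
    have hne2 : e (g.symm (e x)) ≠ e x := fun h => hne' (e.injective h)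
    have h3 : ¬ A.firmPref (g.symm (e x)) (some (e x)) (some (e (g.symm (e x)))) := fun h =>
      he (g.symm (e x)) (e x) hne2 h (by simpa using h2)
    have h4 := (A.firmPref_or_of_ne (g.symm (e x)) (x := some (e x))
      (y := some (e (g.symm (e x)))) (by simpa using hne2.symm)).resolve_left h3
    simpa [hS] using h4
  -- Finiteness turns the injection of `S` into a bijection, so `S` is also closed under the inverse
  -- map.
  have hsurj : Set.BijOn (fun x => g.symm (e x)) S S := by
    refine ((Set.toFinite S).injOn_iff_bijOn_of_mapsTo hmaps).1 ?_
    exact (g.symm.injective.comp e.injective).injOn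
  have hback : ∀ x ∈ S, e.symm (g x) ∈ S := by
    intro x hx
    obtain ⟨y, hy, rfl⟩ := hsurj.surjOn hx
    simpa using hy
  have hfz : f ≠ z := fun h => hzS (h ▸ hf)
  have hgf : g f ≠ e z := by
    intro h
    apply hzS
    simpa [h] using hback f hf
  have h1 : A.firmPref f (some (e z)) (some (g f)) := hz.next_best f hfz _ hf hgf
  have h2 := hg f (e z) hgf h1
  set f₀ := g.symm (e z) with hf₀
  have hgf₀ : g f₀ = e z := by simp [hf₀]
  have hf₀S : f₀ ∉ S := fun h => hzS (by simpa [hgf₀] using hback f₀ h)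
  have h3 : A.workerPref (e z) (some f₀) (some f) := by
    refine (A.workerPref_or_of_ne _ ?_).resolve_right h2
    intro h
    exact hgf (by rw [← hgf₀, Option.some.inj h])
  have h4 : A.workerPref (e z) (some f) (some z) := by
    have := hz'.pref_of_ne f (by simpa using hfz)
    rwa [Equiv.symm_apply_apply] at this
  have h5 := A.workerPref_trans h3 h4
  have hne : f₀ ≠ z := fun h => A.workerPref_irrefl _ _ (h ▸ h5)
  have hne' : e f₀ ≠ e z := fun h => hne (e.injective h)
  have h6 : A.firmPref f₀ (some (e z)) (some (e f₀)) := by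
    refine (A.firmPref_or_of_ne _ ?_).resolve_right fun h => hf₀S (by simpa [hS, hgf₀] using h)
    simpa using hne'.symm
  exact he f₀ (e z) hne' h6 (by simpa using h5)

/-- A stable matching `e` with a pair that is a sink on both sides is the only stable matching. -/
lemma IsSink.existsUnique_isStable [Finite F] {A : Market F W} {e : F ≃ W} {z : F}
    (he : A.IsStable e.toPEquiv) (hz : A.IsSink e z) (hz' : A.swap.IsSink e.symm (e z)) :
    ∃! μ, A.IsStable μ := by
  have : Finite W := .of_equiv F e
  refine ⟨e.toPEquiv, he, fun ν hν => ?_⟩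
  obtain ⟨g, rfl⟩ := hν.exists_eq_toPEquiv e
  have h1 := IsSink.not_firmPref he hν hz hz'
  have h2 : ∀ w, ¬ A.workerPref w (some (e.symm w)) (some (g.symm w)) :=
    IsSink.not_firmPref (A := A.swap) (e := e.symm) (g := g.symm)
      (by rw [Equiv.toPEquiv_symm]; exact isStable_swap.2 he)
      (by rw [Equiv.toPEquiv_symm]; exact isStable_swap.2 hν) hz'
      (by rw [Equiv.symm_symm, Equiv.symm_apply_apply]; exact hz)
  congr 1
  ext f
  by_contra hne
  have h3 := (A.firmPref_or_of_ne f (x := some (e f)) (y := some (g f))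
    (by simpa using Ne.symm hne)).resolve_left (h1 f)
  have hne' : e.symm (g f) ≠ f := fun h => hne (by rwa [Equiv.symm_apply_eq] at h)
  have h4 := (A.workerPref_or_of_ne (g f) (x := some (e.symm (g f))) (y := some f)
    (by simpa using hne')).resolve_left (by simpa using h2 (g f))
  exact he f (g f) ⟨by simpa using Ne.symm hne, by simpa using h3, by simpa using h4⟩

end Market

/-! ### Preferences in the augmented market. -/

open Classical in
/-- The number of elements that are preferred to `x`. -/
noncomputable def prefRank {α : Type*} [Fintype α] (r : α → α → Prop) (x : α) : ℕ :=
  Finset.card {y | r y x}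

open Classical in
lemma prefRank_lt_iff {α : Type*} [Fintype α] {r : α → α → Prop} (hr : IsStrictTotalOrder α r)
    {x y : α} : prefRank r x < prefRank r y ↔ r x y := by
  have key : ∀ {a b}, r a b → prefRank r a < prefRank r b := by
    intro a b hab
    refine Finset.card_lt_card (Finset.ssubset_iff_subset_ne.2 ⟨?_, ?_⟩)
    · intro c hc
      simp only [Finset.mem_filter_univ] at hc ⊢
      exact trans_of r hc hab
    · intro h
      have : a ∈ ({c | r c b} : Finset α) := by simpa using hab
      rw [← h] at this
      exact irrefl_of r a (by simpa using this)
  refine ⟨fun h => ?_, key⟩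
  rcases trichotomous_of r x y with h' | rfl | h'
  · exact h'
  · exact absurd h (lt_irrefl _)
  · exact absurd (key h') h.not_gt

lemma prefRank_injective {α : Type*} [Fintype α] {r : α → α → Prop}
    (hr : IsStrictTotalOrder α r) : Function.Injective (prefRank r) := by
  intro x y h
  rcases trichotomous_of r x y with h' | h' | h'
  · exact absurd ((prefRank_lt_iff hr).2 h') (by omega)
  · exact h'
  · exact absurd ((prefRank_lt_iff hr).2 h') (by omega)

section Augmentation

variable {n k : ℕ}

/-- The position, in lexicographic order, of an option in the preferences of an agent of one side of
the augmented market. The original agents have preferences `r` and stable partners `e`; they rank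
all new agents just below their stable partner. The stable partner of the new agent `i` is the new
agent `i` of the other side, who is ranked below all original agents and, if `i ≠ 0`, below those
new agents `j ≠ 0` for which `i + j` has parity `p`; the new agent `0` comes next. The stable
partner of the new agent `0` is its last choice. -/
noncomputable def augKey (r : Fin n → Option (Fin n) → Option (Fin n) → Prop) (e : Fin n → Fin n)
    (p : ℕ) : Fin n ⊕ Fin k → Option (Fin n ⊕ Fin k) → ℕ × ℕ
  | .inl f, some (.inl w) =>
    (if prefRank (r f) (some w) ≤ prefRank (r f) (some (e f)) then 0 else 2,
      prefRank (r f) (some w))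
  | .inl _, some (.inr j) => (1, j)
  | .inl _, none => (3, 0)
  | .inr _, some (.inl w) => (0, w)
  | .inr i, some (.inr j) =>
    if (i : ℕ) = j then (2, 0) else if (j : ℕ) = 0 then (3, 0) else
      if (i : ℕ) = 0 ∨ (i + j : ℕ) % 2 = p then (1, j) else (4, j)
  | .inr _, none => (5, 0)

/-- The preferences of the agents of one side of the augmented market. -/
def augPref (r : Fin n → Option (Fin n) → Option (Fin n) → Prop) (e : Fin n → Fin n)
    (p : ℕ) (a : Fin n ⊕ Fin k) (x y : Option (Fin n ⊕ Fin k)) : Prop :=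
  (augKey r e p a x).1 < (augKey r e p a y).1 ∨
    (augKey r e p a x).1 = (augKey r e p a y).1 ∧ (augKey r e p a x).2 < (augKey r e p a y).2

variable {r : Fin n → Option (Fin n) → Option (Fin n) → Prop} {e : Fin n → Fin n} {p : ℕ}

lemma augKey_injective (hr : ∀ a, IsStrictTotalOrder (Option (Fin n)) (r a))
    (a : Fin n ⊕ Fin k) : Function.Injective (augKey r e p a) := by
  have hsome : ∀ f (w w' : Fin n), prefRank (r f) (some w) = prefRank (r f) (some w') → w = w' :=
    fun f w w' h => Option.some.inj (prefRank_injective (hr f) h)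
  intro x y hxy
  rcases a with f | i <;> rcases x with _ | w | j <;> rcases y with _ | w' | j'
  all_goals first
    | rfl
    | (exfalso; simp [augKey] at hxy; done)
    | (exfalso; simp only [augKey] at hxy; split_ifs at hxy <;> simp at hxy; done)
    | skip
  · rw [hsome _ _ _ (congrArg Prod.snd hxy)]
  · rw [Fin.ext (congrArg Prod.snd hxy)]
  · rw [Fin.ext (congrArg Prod.snd hxy)]
  · refine congrArg _ (congrArg _ (Fin.ext ?_))
    simp only [augKey] at hxy
    split_ifs at hxy <;> simp at hxy <;> omega

lemma augPref_isStrictTotalOrder (hr : ∀ a, IsStrictTotalOrder (Option (Fin n)) (r a))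
    (a : Fin n ⊕ Fin k) :
    IsStrictTotalOrder (Option (Fin n ⊕ Fin k)) (augPref r e p a) where
  trichotomous x y h1 h2 := by
    unfold augPref at h1 h2
    exact augKey_injective (e := e) (p := p) hr a (Prod.ext (by omega) (by omega))
  irrefl x := by unfold augPref; omega
  trans x y z (h1 : augPref r e p a x y) (h2 : augPref r e p a y z) := by
    unfold augPref at h1 h2 ⊢
    omega

lemma augPref_acceptable (a b : Fin n ⊕ Fin k) : augPref r e p a (some b) none := by
  unfold augPref
  rcases a with f | i <;> rcases b with w | j <;> simp only [augKey] <;> left <;> try split_ifs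
  all_goals simp

/-- The new agents are inserted at a threshold of the original ranking, which leaves the order of
the original options unchanged. -/
lemma augPref_inl_iff (hr : ∀ a, IsStrictTotalOrder (Option (Fin n)) (r a))
    (hacc : ∀ a b, r a (some b) none) (a : Fin n) (x y : Option (Fin n)) :
    augPref r e p (k := k) (.inl a) (x.map .inl) (y.map .inl) ↔ r a x y := by
  have hlt := fun x y => prefRank_lt_iff (hr a) (x := x) (y := y)
  rcases x with _ | x <;> rcases y with _ | y <;>
    simp only [Option.map_none, Option.map_some, augPref, augKey]
  · simpa using fun h => (hr a).irrefl _ h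
  · have : ¬ r a none (some y) := fun h => (hr a).irrefl _ ((hr a).trans _ _ _ h (hacc a y))
    split_ifs <;> simp [this]
  · have := hacc a x
    split_ifs <;> simp [this]
  · rw [← hlt]
    split_ifs <;> simp <;> omega

/-- A new agent is not preferred by an original agent to its stable partner. -/
lemma not_augPref_inl_inr (a : Fin n) (j : Fin k) :
    ¬ augPref r e p (.inl a) (some (.inr j)) (some (.inl (e a))) := by
  simp [augPref, augKey]

lemma augPref_inr_inl (i : Fin k) (b : Fin n) :
    augPref r e p (.inr i) (some (.inl b)) (some (.inr i)) := by
  simp [augPref, augKey]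

lemma augPref_inr_inr_iff (i j : Fin k) :
    augPref r e p (.inr i) (some (.inr j)) (some (.inr i)) ↔
      (i : ℕ) ≠ j ∧ (j : ℕ) ≠ 0 ∧ ((i : ℕ) = 0 ∨ (i + j : ℕ) % 2 = p) := by
  simp only [augPref, augKey]
  split_ifs <;> simp <;> omega

lemma augPref_inl_next_best (a : Fin n) {z : Fin k} (hz : (z : ℕ) = 0) (b : Fin n ⊕ Fin k)
    (h : augPref r e p (.inl a) (some (.inl (e a))) (some b)) (hb : b ≠ .inr z) :
    augPref r e p (.inl a) (some (.inr z)) (some b) := by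
  unfold augPref at *
  rcases b with b | j
  · simp only [augKey] at *
    split_ifs at * <;> simp at *; omega
  · have : (j : ℕ) ≠ 0 := fun h => hb (by rw [Fin.ext (h.trans hz.symm)])
    refine .inr ⟨rfl, ?_⟩
    simp only [augKey]
    omega

lemma augPref_inr_next_best (i : Fin k) {z : Fin k} (hz : (z : ℕ) = 0) (hi : i ≠ z)
    (b : Fin n ⊕ Fin k)
    (h : augPref r e p (.inr i) (some (.inr i)) (some b)) (hb : b ≠ .inr z) :
    augPref r e p (.inr i) (some (.inr z)) (some b) := by
  have hi : (i : ℕ) ≠ 0 := fun h => hi (Fin.ext (h.trans hz.symm))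
  unfold augPref at *
  rcases b with b | j
  · simp [augKey] at h
  · have : (j : ℕ) ≠ 0 := fun h => hb (by rw [Fin.ext (h.trans hz.symm)])
    simp only [augKey] at *
    split_ifs at * <;> simp at *

/-- Every agent but the new agent `0` is preferred to their stable partners by about half of the new
agents of the other side. -/
lemma exists_le_card_augPref {m : ℕ} (hk : k = 2 * m + 3) (hp : p < 2) {z : Fin k}
    (hz : (z : ℕ) = 0) (a : Fin n ⊕ Fin k) (ha : a ≠ .inr z) :
    ∃ s : Finset (Fin n ⊕ Fin k), m ≤ s.card ∧
      ∀ b ∈ s, augPref r e p b (some a) (some (b.map e id)) := by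
  classical
  rcases a with f | i
  · refine ⟨Finset.univ.map ⟨Sum.inr, Sum.inr_injective⟩, by simp; omega, ?_⟩
    intro b hb
    obtain ⟨j, -, rfl⟩ := Finset.mem_map.1 hb
    exact augPref_inr_inl j f
  · have hi : (i : ℕ) ≠ 0 := fun h => ha (by rw [Fin.ext (h.trans hz.symm)])
    -- These are `m + 1` nonzero indices whose sum with `i` has parity `p`; none exceeds `2 * m + 2
    -- < k`. One of them may be `i` itself, and its removal leaves at least `m`.
    let g : Fin (m + 1) → Fin n ⊕ Fin k := fun t =>
      .inr ⟨2 * t + 1 + (i + 1 + p) % 2, by omega⟩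
    have hg : Function.Injective g := by
      intro t t' h
      have := congrArg Fin.val (Sum.inr_injective h)
      simp only at this
      exact Fin.ext (by omega)
    refine ⟨(Finset.univ.image g).erase (.inr i), ?_, ?_⟩
    · have := Finset.pred_card_le_card_erase (s := Finset.univ.image g) (a := .inr i)
      rw [Finset.card_image_of_injective _ hg, Finset.card_fin] at this
      omega
    · intro b hb
      obtain ⟨hne, hb⟩ := Finset.mem_erase.1 hb
      obtain ⟨t, -, rfl⟩ := Finset.mem_image.1 hb
      refine (augPref_inr_inr_iff _ i).2 ⟨?_, hi, .inr ?_⟩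
      · intro h
        exact hne (congrArg Sum.inr (Fin.ext h))
      · simp only
        omega

end Augmentation

/-! ### The augmented market: stability, sink, uniqueness. -/

namespace Market

variable {n k : ℕ}

/-- The augmentation by `k` new firms and `k` new workers of a market with stable matching `e`. -/
noncomputable def augment (k : ℕ) (M : Market (Fin n) (Fin n)) (e : Fin n ≃ Fin n) :
    Market (Fin n ⊕ Fin k) (Fin n ⊕ Fin k) where
  firmPref := augPref M.firmPref e 1
  workerPref := augPref M.workerPref e.symm 0
  firmPref_strictTotal := augPref_isStrictTotalOrder M.firmPref_strictTotal
  workerPref_strictTotal := augPref_isStrictTotalOrder M.workerPref_strictTotal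
  firm_acceptable := augPref_acceptable
  worker_acceptable := augPref_acceptable

/-- The extension of a matching of the original agents by the pairs of new agents. -/
abbrev augEquiv (k : ℕ) (e : Fin n ≃ Fin n) : Fin n ⊕ Fin k ≃ Fin n ⊕ Fin k :=
  e.sumCongr (Equiv.refl _)

variable {M : Market (Fin n) (Fin n)} {e : Fin n ≃ Fin n}

lemma augment_firmPref_iff (f : Fin n) (x y : Option (Fin n)) :
    (M.augment k e).firmPref (.inl f) (x.map .inl) (y.map .inl) ↔ M.firmPref f x y :=
  augPref_inl_iff M.firmPref_strictTotal M.firm_acceptable f x y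

lemma augment_workerPref_iff (w : Fin n) (x y : Option (Fin n)) :
    (M.augment k e).workerPref (.inl w) (x.map .inl) (y.map .inl) ↔ M.workerPref w x y :=
  augPref_inl_iff M.workerPref_strictTotal M.worker_acceptable w x y

/-- Original agents prefer no new agent to their stable partner, so a blocking pair would consist of
two original or of two new agents. -/
lemma augment_isStable (he : M.IsStable e.toPEquiv) :
    (M.augment k e).IsStable (augEquiv k e).toPEquiv := by
  rintro (f | i) (w | j) ⟨hne, hf, hw⟩ <;>
    simp only [Equiv.toPEquiv_apply, Equiv.toPEquiv_symm_apply, augEquiv, Equiv.sumCongr_apply,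
      Equiv.sumCongr_symm, Sum.map_inl, Sum.map_inr, Equiv.refl_symm, Equiv.refl_apply,
      Ne, Option.some.injEq, Sum.inl.injEq, Sum.inr.injEq] at hne hf hw
  · exact he f w ⟨by simpa using hne,
      by simpa using (augment_firmPref_iff f (some w) (some (e f))).1 hf,
      by simpa using (augment_workerPref_iff w (some f) (some (e.symm w))).1 hw⟩
  · exact not_augPref_inl_inr _ _ hf
  · exact not_augPref_inl_inr _ _ hw
  -- Both indices would be nonzero, with a sum that is odd for the firm and even for the worker.
  · have h1 := (augPref_inr_inr_iff i j).1 hf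
    have h2 := (augPref_inr_inr_iff j i).1 hw
    omega

lemma augment_isSink {z : Fin k} (hz : (z : ℕ) = 0) :
    (M.augment k e).IsSink (augEquiv k e) (.inr z) where
  pref_of_ne w hw := by
    rcases w with w | j
    · exact augPref_inr_inl _ _
    · refine (augPref_inr_inr_iff z j).2 ?_
      have : (j : ℕ) ≠ z := fun h => hw (by simp [Fin.ext h])
      omega
  next_best f hf w h hw := by
    rcases f with f | i
    · exact augPref_inl_next_best f hz w h hw
    · exact augPref_inr_next_best i hz (fun h => hf (by rw [h])) w h hw

lemma augment_swap_isSink {z : Fin k} (hz : (z : ℕ) = 0) :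
    (M.augment k e).swap.IsSink (augEquiv k e).symm (augEquiv k e (.inr z)) where
  pref_of_ne w hw := by
    rcases w with w | j
    · exact augPref_inr_inl _ _
    · refine (augPref_inr_inr_iff z j).2 ?_
      have : (j : ℕ) ≠ z := fun h => hw (by simp [Fin.ext h])
      omega
  next_best f hf w h hw := by
    rcases f with f | i
    · exact augPref_inl_next_best f hz w h hw
    · exact augPref_inr_next_best i hz (fun h => hf (by rw [h]; rfl)) w h hw

lemma augment_exists_workers {m : ℕ} (hk : k = 2 * m + 3) {z : Fin k} (hz : (z : ℕ) = 0)
    (f : Fin n ⊕ Fin k) (hf : f ≠ .inr z) : ∃ s : Finset (Fin n ⊕ Fin k), m ≤ s.card ∧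
      ∀ w ∈ s, (M.augment k e).workerPref w (some f) (some ((augEquiv k e).symm w)) :=
  exists_le_card_augPref hk (by norm_num) hz f hf

lemma augment_exists_firms {m : ℕ} (hk : k = 2 * m + 3) {z : Fin k} (hz : (z : ℕ) = 0)
    (w : Fin n ⊕ Fin k) (hw : w ≠ .inr z) : ∃ s : Finset (Fin n ⊕ Fin k), m ≤ s.card ∧
      ∀ f ∈ s, (M.augment k e).firmPref f (some w) (some (augEquiv k e f)) :=
  exists_le_card_augPref hk (by norm_num) hz w hw

lemma augment_existsUnique (hM : ∃! μ, M.IsStable μ) (he : M.IsStable e.toPEquiv) :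
    ∃! μ, (M.augment k e).IsStable μ := by
  -- Without new agents there is no sink, and uniqueness is carried over from `M` along `Fin n ⊕ Fin
  -- 0 ≃ Fin n`.
  rcases k.eq_zero_or_pos with rfl | hk
  · refine ⟨_, augment_isStable he, fun ν hν => ?_⟩
    set s := Equiv.sumEmpty (Fin n) (Fin 0)
    obtain ⟨g, rfl⟩ := hν.exists_eq_toPEquiv (augEquiv 0 e)
    set h := s.symm.trans (g.trans s) with hh
    have hs : ∀ x : Fin n ⊕ Fin 0, Sum.inl (s x) = x := fun x => s.symm_apply_apply x
    have hst : M.IsStable h.toPEquiv := by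
      rintro f w ⟨hne, hf, hw⟩
      refine hν (.inl f) (.inl w) ⟨?_, ?_, ?_⟩
      · intro h'
        apply hne
        have h' : g (.inl f) = .inl w := by simpa using h'
        change some (s (g (.inl f))) = _
        rw [h']; rfl
      · have := (augment_firmPref_iff (k := 0) (e := e) _ _ _).2 hf
        have h2 : (h.toPEquiv f).map Sum.inl = g.toPEquiv (.inl f) := by
          simp only [Equiv.toPEquiv_apply, Option.map_some]
          exact congrArg _ (hs (g (.inl f)))
        rwa [h2] at this
      · have := (augment_workerPref_iff (k := 0) (e := e) _ _ _).2 hw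
        have h2 : (h.toPEquiv.symm w).map Sum.inl = g.toPEquiv.symm (.inl w) := by
          simp only [Equiv.toPEquiv_symm_apply, Option.map_some]
          exact congrArg _ (hs (g.symm (.inl w)))
        rwa [h2] at this
    have heq := hM.unique hst he
    refine PEquiv.ext ?_
    rintro (f | i)
    · have := DFunLike.congr_fun heq f
      simp only [Equiv.toPEquiv_apply, Option.some.injEq] at this ⊢
      rw [← hs (g (.inl f))]
      exact congrArg Sum.inl this
    · exact i.elim0
  · exact IsSink.existsUnique_isStable (z := .inr ⟨0, hk⟩) (augment_isStable he)
      (augment_isSink rfl) (augment_swap_isSink rfl)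

lemma augment_isAugmentation (hM : ∃! μ, M.IsStable μ) (he : M.IsStable e.toPEquiv) {δ : ℝ}
    (hk : (k : ℝ) ≤ δ * n) : M.IsAugmentation δ (M.augment k e) where
  card_firms := by simpa using hk
  card_workers := by simpa using hk
  firmPref_iff := augment_firmPref_iff
  workerPref_iff := augment_workerPref_iff
  unique_stable := augment_existsUnique hM he
  firm_partner μ μ' hμ hμ' f := by
    rw [hM.unique hμ he, (augment_existsUnique hM he).unique hμ' (augment_isStable he)]
    simp
  worker_partner μ μ' hμ hμ' w := by
    rw [hM.unique hμ he, (augment_existsUnique hM he).unique hμ' (augment_isStable he)]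
    simp

end Market

/-! ### Effect of one step on the distance and the level. -/

namespace Matching

variable {F W : Type*}

section Satisfy

variable [DecidableEq F] [DecidableEq W] (μ : Matching F W) (f : F) (w : W)

lemma satisfy_apply (f' : F) : μ.satisfy f w f' =
    if f' = f then some w else if μ f' = some w then none else μ f' := rfl

lemma satisfy_symm_apply (w' : W) : (μ.satisfy f w).symm w' =
    if w' = w then some f else if μ.symm w' = some f then none else μ.symm w' := rfl

lemma satisfy_symm : (μ.satisfy f w).symm = Matching.satisfy μ.symm w f :=
  PEquiv.ext fun w' => by rw [satisfy_symm_apply, satisfy_apply]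

variable {μ f w}

/-- The former partner of the worker in a satisfied pair becomes single. -/
lemma satisfy_apply_eq_none {x : F} (hx : μ x = some w) (hf : μ f ≠ some w) :
    μ.satisfy f w x = none := by
  have : x ≠ f := fun h => hf (h ▸ hx)
  simp [satisfy_apply, this, hx]

/-- The former partner of the firm in a satisfied pair becomes single. -/
lemma satisfy_symm_apply_eq_none {y : W} (hy : μ f = some y) (hf : μ f ≠ some w) :
    (μ.satisfy f w).symm y = none := by
  have : y ≠ w := fun h => hf (h ▸ hy)
  simp [satisfy_symm_apply, this, (μ.eq_some_iff).2 hy]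

lemma satisfy_apply_of_eq_none {x : F} (hx : μ x = none) (hxf : x ≠ f) :
    μ.satisfy f w x = none := by
  simp [satisfy_apply, hxf, hx]

/-- Satisfying distinct pairs leads to distinct matchings. -/
lemma satisfy_inj {f' : F} {w' : W} (h : μ f ≠ some w)
    (heq : μ.satisfy f w = μ.satisfy f' w') : f = f' ∧ w = w' := by
  have h1 := DFunLike.congr_fun heq f
  simp only [satisfy_apply, if_true] at h1
  split_ifs at h1 with h2 h3
  · exact ⟨h2, Option.some.inj h1⟩
  · exact absurd h1.symm h

end Satisfy

section Potential

variable [DecidableEq W] (e : F ≃ W) (z : F) (μ : Matching F W)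

/-- The number of firms that are not matched with their partners at `e`. -/
def distance [Fintype F] : ℕ := Finset.card {f | μ f ≠ some (e f)}

/-- No agents, except possibly those of the pair `(z, e z)`, are single. -/
def IsNearPerfect (e : F ≃ W) (z : F) (μ : Matching F W) : Prop :=
  (∀ f, f ≠ z → μ f ≠ none) ∧ ∀ w, w ≠ e z → μ.symm w ≠ none

open Classical in
/-- A bound on the number of steps from `μ` until a matching that is not nearly perfect is reached. -/
noncomputable def level : ℕ :=
  if IsNearPerfect e z μ then if μ z = some (e z) then 1 else if μ z = none then 2 else 3 else 0

lemma level_le : level e z μ ≤ 3 := by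
  unfold level
  split_ifs <;> omega

variable {e z μ}

lemma level_of_not (h : ¬ IsNearPerfect e z μ) : level e z μ = 0 := by simp [level, h]

variable [Fintype F] [DecidableEq F]

/-- Only `f` can gain a partner among the firms. -/
lemma distance_lt_iff {f : F} {w : W} (h : (μ.satisfy f w).distance e < μ.distance e) :
    w = e f ∧ μ f ≠ some (e f) := by
  by_contra! hcon
  refine h.not_ge (Finset.card_le_card fun x hx => ?_)
  simp only [Finset.mem_filter_univ] at hx ⊢
  rw [satisfy_apply]
  split_ifs with h1 h2
  · intro h3
    rw [Option.some_inj] at h3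
    subst h1
    exact hx (hcon h3)
  · simp
  · exact hx

lemma distance_le_satisfy (f : F) (w : W) : μ.distance e ≤ (μ.satisfy f w).distance e + 1 := by
  have : ({x | μ x ≠ some (e x)} : Finset F) ⊆
      insert f ({x | μ.satisfy f w x ≠ some (e x)} : Finset F) := fun x hx => by
    simp only [Finset.mem_filter_univ, Finset.mem_insert] at hx ⊢
    by_cases h : x = f
    · exact .inl h
    · right
      rw [satisfy_apply, if_neg h]
      split_ifs
      · simp
      · exact hx
  exact (Finset.card_le_card this).trans (Finset.card_insert_le _ _)

/-- Breaking a pair of `e` increases the distance from `e`. -/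
lemma distance_lt_satisfy {f : F} {w : W} (hw : μ (e.symm w) = some w) (hf : f ≠ e.symm w) :
    μ.distance e < (μ.satisfy f w).distance e := by
  refine Finset.card_lt_card (Finset.ssubset_iff_of_subset ?_ |>.2 ⟨e.symm w, ?_, by simp [hw]⟩)
  · intro x hx
    simp only [Finset.mem_filter_univ] at hx ⊢
    rw [satisfy_apply]
    split_ifs with h1 h2
    · rw [Ne, Option.some_inj]
      rintro rfl
      exact hf (by simp [h1])
    · simp
    · exact hx
  · rw [Finset.mem_filter_univ, satisfy_apply, if_neg hf.symm]
    simp [hw]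

/-- From a nearly perfect matching, every step decreases the level. -/
lemma level_satisfy_lt {f : F} {w : W} (hμ : IsNearPerfect e z μ) (hfw : μ f ≠ some w) :
    level e z (μ.satisfy f w) < level e z μ := by
  classical
  have hpos : 0 < level e z μ := by
    unfold level
    rw [if_pos hμ]
    split_ifs <;> omega
  by_cases hν : IsNearPerfect e z (μ.satisfy f w)
  swap
  · rwa [level_of_not hν]
  -- Former partners other than `z` and `e z` cannot have become single.
  have hx : ∀ x, μ x = some w → x = z := fun x hx => by
    by_contra h
    exact hν.1 x h (satisfy_apply_eq_none hx hfw)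
  have hy : ∀ y, μ f = some y → y = e z := fun y hy => by
    by_contra h
    exact hν.2 y h (satisfy_symm_apply_eq_none hy hfw)
  by_cases hz : μ z = none
  -- By counting, the single firm `z` forces a single worker, which can only be `e z`. The step must
  -- then match these two, so the level drops from 2 to 1.
  · have hez : μ.symm (e z) = none := by
      by_contra hez
      refine forall_firm_ne_none e (fun w' => ?_) z hz
      by_cases h : w' = e z
      · rwa [h]
      · exact hμ.2 w' h
    have hf : f = z := by
      by_contra hf
      obtain ⟨y, hy'⟩ := Option.ne_none_iff_exists'.1 (hμ.1 f hf)
      rw [hy y hy', ← PEquiv.eq_some_iff, hez] at hy'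
      simp at hy'
    have hw : w = e z := by
      by_contra hw
      obtain ⟨x, hx'⟩ := Option.ne_none_iff_exists'.1 (hμ.2 w hw)
      rw [PEquiv.eq_some_iff] at hx'
      rw [hx x hx', hz] at hx'
      simp at hx'
    subst hf hw
    simp [level, hμ, hν, hz, satisfy_apply]
  -- Here `μ` is perfect, so both former partners become single and must be `z` and `e z`; the level
  -- drops from 3 to 2.
  · have hall : ∀ f', μ f' ≠ none := fun f' => by
      by_cases h : f' = z
      · rwa [h]
      · exact hμ.1 f' h
    obtain ⟨x, hx'⟩ := Option.ne_none_iff_exists'.1 (forall_worker_ne_none e hall w)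
    rw [PEquiv.eq_some_iff] at hx'
    obtain rfl := hx x hx'
    obtain ⟨y, hy'⟩ := Option.ne_none_iff_exists'.1 (hall f)
    obtain rfl := hy y hy'
    have hxf : x ≠ f := fun h => hfw (h ▸ hx')
    have hw : w ≠ e x := fun h => hxf (μ.inj hx' (by rw [hy', h]; rfl))
    have h1 : μ.satisfy f w x = none := satisfy_apply_eq_none hx' hfw
    simp [level, hμ, hν, hx', h1, hw]

/-- At most three firms can be involved in a step to a nearly perfect matching. -/
lemma exists_firms_of_isNearPerfect (e : F ≃ W) (z : F) (μ : Matching F W) :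
    ∃ s : Finset F, s.card ≤ 3 ∧ ∀ f w, μ f ≠ some w → IsNearPerfect e z (μ.satisfy f w) → f ∈ s := by
  classical
  -- A firm `f ≠ z` either leaves its partner single, which is allowed only for `e z`, or was the
  -- only single firm besides possibly `z`.
  set s₁ : Finset F := {f | μ f = some (e z)} with hs₁
  set s₂ : Finset F :=
    {f | (f ≠ z ∧ ∀ x, x ≠ z → μ x = none → x = f) ∧ μ f = none} with hs₂
  have h₁ : s₁.card ≤ 1 := Finset.card_le_one.2 fun a ha b hb => by
    simp only [hs₁, Finset.mem_filter_univ] at ha hb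
    exact μ.inj ha hb
  have h₂ : s₂.card ≤ 1 := Finset.card_le_one.2 fun a ha b hb => by
    simp only [hs₂, Finset.mem_filter_univ] at ha hb
    exact hb.1.2 a ha.1.1 ha.2
  refine ⟨{z} ∪ s₁ ∪ s₂, ?_, fun f w hfw hν => ?_⟩
  · have h3 := Finset.card_union_le ({z} ∪ s₁) s₂
    have h4 := Finset.card_union_le {z} s₁
    rw [Finset.card_singleton] at h4
    omega
  · simp only [Finset.mem_union, Finset.mem_singleton, hs₁, hs₂,
      Finset.mem_filter_univ]
    by_cases hz : f = z
    · exact .inl (.inl hz)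
    rcases hf : μ f with _ | y
    · refine .inr ⟨⟨hz, fun x hxz hx => ?_⟩, rfl⟩
      by_contra hxf
      exact hν.1 x hxz (satisfy_apply_of_eq_none hx hxf)
    · refine .inl (.inr ?_)
      by_contra hy
      exact hν.2 y (fun h => hy (by rw [h])) (satisfy_symm_apply_eq_none hf hfw)

end Potential

end Matching

noncomputable instance PEquiv.instFintype {F W : Type*} [Finite F] [Finite W] :
    Fintype (F ≃. W) :=
  have : Finite (F ≃. W) := Finite.of_injective _ (DFunLike.coe_injective (F := F ≃. W))
  Fintype.ofFinite _

namespace Matching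

variable {F W : Type*}

lemma isNearPerfect_symm_iff {e : F ≃ W} {z : F} {μ : Matching F W} :
    IsNearPerfect e.symm (e z) μ.symm ↔ IsNearPerfect e z μ := by
  unfold IsNearPerfect
  rw [PEquiv.symm_symm, Equiv.symm_apply_apply]
  exact and_comm

/-! ### The potential. -/

section Weight

variable [Fintype F] [DecidableEq W]

/-- The potential whose expectation essentially does not increase in the dynamics. -/
noncomputable def weight (e : F ≃ W) (z : F) (μ : Matching F W) : ℝ :=
  (1 / 2) ^ μ.distance e * 4 ^ level e z μ

lemma weight_pos (e : F ≃ W) (z : F) (μ : Matching F W) : 0 < weight e z μ := by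
  unfold weight
  positivity

lemma weight_le (e : F ≃ W) (z : F) {μ : Matching F W} {N : ℕ} (h : N ≤ μ.distance e) :
    weight e z μ ≤ 64 * (1 / 2) ^ N := by
  have h1 : (1 / 2 : ℝ) ^ μ.distance e ≤ (1 / 2) ^ N :=
    pow_le_pow_of_le_one (by norm_num) (by norm_num) h
  have h2 : (4 : ℝ) ^ level e z μ ≤ 4 ^ 3 := pow_le_pow_right₀ (by norm_num) (level_le e z μ)
  unfold weight
  calc _ ≤ (1 / 2 : ℝ) ^ N * 4 ^ 3 := by gcongr
    _ = _ := by ring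

lemma weight_of_not {e : F ≃ W} {z : F} {μ : Matching F W} (h : ¬ IsNearPerfect e z μ) :
    weight e z μ = (1 / 2) ^ μ.distance e := by
  simp [weight, level_of_not h]

variable [DecidableEq F]

lemma half_pow_distance_satisfy_le (e : F ≃ W) (μ : Matching F W) (f : F) (w : W) :
    (1 / 2 : ℝ) ^ (μ.satisfy f w).distance e ≤ 2 * (1 / 2) ^ μ.distance e := by
  have h : (1 / 2 : ℝ) ^ ((μ.satisfy f w).distance e + 1) ≤ (1 / 2) ^ μ.distance e :=
    pow_le_pow_of_le_one (by norm_num) (by norm_num) (distance_le_satisfy f w)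
  rw [pow_succ] at h
  linarith

/-- The factor 4 lost with a level outweighs the factor 2 gained when the distance falls by one. -/
lemma weight_satisfy_le_of_isNearPerfect {e : F ≃ W} {z : F} {μ : Matching F W} {f : F} {w : W}
    (hμ : IsNearPerfect e z μ) (hfw : μ f ≠ some w) :
    weight e z (μ.satisfy f w) ≤ weight e z μ := by
  have h1 := half_pow_distance_satisfy_le e μ f w
  have h2 : (4 : ℝ) ^ (level e z (μ.satisfy f w) + 1) ≤ 4 ^ level e z μ :=
    pow_le_pow_right₀ (by norm_num) (level_satisfy_lt hμ hfw)
  rw [pow_succ] at h2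
  unfold weight
  calc _ ≤ (2 * (1 / 2 : ℝ) ^ μ.distance e) * (4 ^ level e z μ / 4) := by
        gcongr
        linarith
    _ ≤ _ := by
        have : (0 : ℝ) < (1 / 2) ^ μ.distance e * 4 ^ level e z μ := by positivity
        linarith

end Weight

variable [Fintype F] [Fintype W] [DecidableEq F] [DecidableEq W]

lemma distance_symm (e : F ≃ W) (μ : Matching F W) :
    distance e.symm μ.symm = μ.distance e := by
  refine Finset.card_equiv e.symm fun w => ?_
  rw [Finset.mem_filter_univ, Finset.mem_filter_univ, Ne, PEquiv.eq_some_iff,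
    Equiv.apply_symm_apply]

/-- At most nine steps lead to a nearly perfect matching. -/
lemma exists_pairs_of_isNearPerfect (e : F ≃ W) (z : F) (μ : Matching F W) :
    ∃ s : Finset (F × W), s.card ≤ 9 ∧
      ∀ f w, μ f ≠ some w → IsNearPerfect e z (μ.satisfy f w) → (f, w) ∈ s := by
  obtain ⟨s, hs, h⟩ := exists_firms_of_isNearPerfect e z μ
  obtain ⟨t, ht, h'⟩ := exists_firms_of_isNearPerfect e.symm (e z) μ.symm
  refine ⟨s ×ˢ t, ?_, fun f w hfw hν => Finset.mk_mem_product (h f w hfw hν) (h' w f ?_ ?_)⟩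
  · rw [Finset.card_product]
    nlinarith
  · rwa [Ne, PEquiv.eq_some_iff]
  · rw [← satisfy_symm, isNearPerfect_symm_iff]
    exact hν

end Matching

/-! ### Counting helpful and harmful steps; the one-step drift. -/

namespace Market

open Matching

variable {F W : Type*}

/-- The worker picks its favourite among the firms with which it blocks. Keeping `w` fixed matters:
the pair broken at `w` does not depend on the firm. -/
lemma exists_firm_isBestBlocking [Finite F] {M : Market F W} {μ : Matching F W} {f : F} {w : W}
    (h : M.IsBlocking μ f w) : ∃ f', M.IsBestBlocking μ f' w := by
  let r : F → F → Prop := fun a b => M.workerPref w (some a) (some b)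
  have : IsTrans F r := ⟨fun _ _ _ => M.workerPref_trans⟩
  have : Std.Irrefl r := ⟨fun _ => M.workerPref_irrefl w _⟩
  have hwf : WellFounded r := Finite.wellFounded_of_trans_of_irrefl r
  obtain ⟨f', hf', hmin⟩ := hwf.has_min {x | M.IsBlocking μ x w} ⟨f, h⟩
  refine ⟨f', hf', .inr fun x hx hne => ?_⟩
  exact (M.workerPref_or_of_ne w (by simpa using hne.symm)).resolve_right (hmin x hx)

variable [Fintype F] [Fintype W] [DecidableEq F] [DecidableEq W]

/-- If a firm is single, then every worker who prefers it to its partner at `e` is either not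
matched with this partner or part of a best blocking pair. -/
lemma exists_pairs_of_single_firm {A : Market F W} {e : F ≃ W} {μ : Matching F W} {f : F}
    (hf : μ f = none) {s : Finset W}
    (hs : ∀ w ∈ s, A.workerPref w (some f) (some (e.symm w))) :
    ∃ P : Finset (F × W), s.card ≤ P.card + μ.distance e ∧
      ∀ p ∈ P, A.IsBestBlocking μ p.1 p.2 ∧ μ.distance e < (μ.satisfy p.1 p.2).distance e := by
  set u : Finset W := {w | μ.symm w ≠ some (e.symm w)} with hu
  have hucard : u.card = μ.distance e := distance_symm e μ
  have hsym : ∀ w, w ∉ u → μ (e.symm w) = some w := fun w hw => by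
    rw [← PEquiv.eq_some_iff]
    simpa [hu] using hw
  have hbl : ∀ w : W, ∃ f', w ∈ s \ u → A.IsBestBlocking μ f' w := by
    intro w
    by_cases hw : w ∈ s \ u
    · obtain ⟨hws, hwu⟩ := Finset.mem_sdiff.1 hw
      have h1 : μ.symm w = some (e.symm w) := (μ.eq_some_iff).2 (hsym w hwu)
      have : A.IsBlocking μ f w :=
        ⟨by simp [hf], hf ▸ A.firm_acceptable f w, h1 ▸ hs w hws⟩
      obtain ⟨f', hf'⟩ := exists_firm_isBestBlocking this
      exact ⟨f', fun _ => hf'⟩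
    · exact ⟨f, fun h => absurd h hw⟩
  choose g hg using hbl
  -- Indexing by workers keeps the pairs distinct even if several workers choose the same firm.
  refine ⟨(s \ u).map ⟨fun w => (g w, w), fun a b h => (Prod.ext_iff.1 h).2⟩, ?_, ?_⟩
  · rw [Finset.card_map, ← hucard]
    exact (Finset.card_le_card (by simp)).trans (Finset.card_union_le _ _)
  · intro p hp
    obtain ⟨w, hw, rfl⟩ := Finset.mem_map.1 hp
    have hb := hg w hw
    have h1 := hsym w (Finset.mem_sdiff.1 hw).2
    exact ⟨hb, distance_lt_satisfy h1 fun h => hb.1.1 ((congrArg μ h).trans h1)⟩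

lemma exists_pairs_of_single_worker {A : Market F W} {e : F ≃ W} {μ : Matching F W} {w : W}
    (hw : μ.symm w = none) {s : Finset F}
    (hs : ∀ f ∈ s, A.firmPref f (some w) (some (e f))) :
    ∃ P : Finset (F × W), s.card ≤ P.card + μ.distance e ∧
      ∀ p ∈ P, A.IsBestBlocking μ p.1 p.2 ∧ μ.distance e < (μ.satisfy p.1 p.2).distance e := by
  obtain ⟨P, hP, h⟩ := exists_pairs_of_single_firm (A := A.swap) (e := e.symm) hw hs
  rw [distance_symm] at hP
  refine ⟨P.map (Equiv.prodComm W F).toEmbedding, by simpa using hP, fun p hp => ?_⟩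
  obtain ⟨q, hq, rfl⟩ := Finset.mem_map.1 hp
  obtain ⟨h1, h2⟩ := h q hq
  rw [← satisfy_symm, distance_symm, distance_symm] at h2
  exact ⟨isBestBlocking_swap.1 h1, h2⟩

/-- Every agent outside the pair `(z, e z)` is preferred by at least `m` agents of the other side to
their partners at `e`. -/
structure IsAttractive (A : Market F W) (e : F ≃ W) (z : F) (m : ℕ) : Prop where
  firm : ∀ f, f ≠ z → ∃ s : Finset W, m ≤ s.card ∧
    ∀ w ∈ s, A.workerPref w (some f) (some (e.symm w))
  worker : ∀ w, w ≠ e z → ∃ s : Finset F, m ≤ s.card ∧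
    ∀ f ∈ s, A.firmPref f (some w) (some (e f))

lemma IsAttractive.exists_pairs {A : Market F W} {e : F ≃ W} {z : F} {m : ℕ}
    (hA : A.IsAttractive e z m) {μ : Matching F W} (hμ : ¬ IsNearPerfect e z μ) :
    ∃ P : Finset (F × W), m ≤ P.card + μ.distance e ∧
      ∀ p ∈ P, A.IsBestBlocking μ p.1 p.2 ∧ μ.distance e < (μ.satisfy p.1 p.2).distance e := by
  unfold IsNearPerfect at hμ
  rw [not_and_or] at hμ
  push Not at hμ
  rcases hμ with ⟨f, hfz, hf⟩ | ⟨w, hwz, hw⟩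
  · obtain ⟨s, hs, h⟩ := hA.firm f hfz
    obtain ⟨P, hP, h'⟩ := exists_pairs_of_single_firm hf h
    exact ⟨P, hs.trans hP, h'⟩
  · obtain ⟨s, hs, h⟩ := hA.worker w hwz
    obtain ⟨P, hP, h'⟩ := exists_pairs_of_single_worker hw h
    exact ⟨P, hs.trans hP, h'⟩

/-- The matchings reached from `μ` by increasing the distance from `e`. -/
lemma IsAttractive.exists_matchings {A : Market F W} {e : F ≃ W} {z : F} {m : ℕ}
    (hA : A.IsAttractive e z m) {μ : Matching F W} (hμ : ¬ IsNearPerfect e z μ) :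
    ∃ U : Finset (Matching F W), m ≤ U.card + μ.distance e + 9 ∧
      ∀ ν ∈ U, (∃ f w, A.IsBestBlocking μ f w ∧ ν = μ.satisfy f w) ∧
        weight e z ν ≤ weight e z μ / 2 := by
  classical
  obtain ⟨P, hP, h⟩ := hA.exists_pairs hμ
  obtain ⟨t, ht, h'⟩ := exists_pairs_of_isNearPerfect e z μ
  have hinj : Set.InjOn (fun p : F × W => μ.satisfy p.1 p.2) (P \ t : Finset (F × W)) := by
    intro p hp q hq hpq
    have hp' := (h p (Finset.mem_sdiff.1 hp).1).1.1.1
    exact Prod.ext_iff.2 (satisfy_inj hp' hpq)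
  -- Pairs leading to nearly perfect matchings are discarded, since there the factor `4 ^ level`
  -- could undo the halving.
  refine ⟨(P \ t).image fun p => μ.satisfy p.1 p.2, ?_, ?_⟩
  · rw [Finset.card_image_of_injOn hinj]
    have := Finset.le_card_sdiff t P
    omega
  · intro ν hν
    obtain ⟨p, hp, rfl⟩ := Finset.mem_image.1 hν
    obtain ⟨hpP, hpt⟩ := Finset.mem_sdiff.1 hp
    obtain ⟨hb, hd⟩ := h p hpP
    refine ⟨⟨p.1, p.2, hb, rfl⟩, ?_⟩
    rw [weight_of_not hμ, weight_of_not fun hν => hpt (h' p.1 p.2 hb.1.1 hν)]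
    have : (1 / 2 : ℝ) ^ (μ.satisfy p.1 p.2).distance e ≤ (1 / 2) ^ (μ.distance e + 1) :=
      pow_le_pow_of_le_one (by norm_num) (by norm_num) hd
    rw [pow_succ] at this
    linarith

/-- Few steps increase the weight. -/
lemma exists_pairs_weight_le (e : F ≃ W) (z : F) (μ : Matching F W) :
    ∃ s : Finset (F × W), s.card ≤ μ.distance e + 9 ∧
      ∀ f w, μ f ≠ some w → ¬ IsNearPerfect e z μ → (f, w) ∉ s →
        weight e z (μ.satisfy f w) ≤ weight e z μ := by
  classical
  obtain ⟨t, ht, h'⟩ := exists_pairs_of_isNearPerfect e z μ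
  set d : Finset F := {f | μ f ≠ some (e f)} with hd
  -- The weight can rise only by re-forming a lost pair of `e` or by reaching a nearly perfect
  -- matching.
  refine ⟨d.image (fun f => (f, e f)) ∪ t, ?_, ?_⟩
  · exact (Finset.card_union_le _ _).trans (add_le_add Finset.card_image_le ht)
  · intro f w hfw hμ hs
    rw [Finset.mem_union, not_or] at hs
    rw [weight_of_not hμ, weight_of_not fun hν => hs.2 (h' f w hfw hν)]
    refine pow_le_pow_of_le_one (by norm_num) (by norm_num) (not_lt.1 fun hlt => hs.1 ?_)
    obtain ⟨rfl, hf⟩ := distance_lt_iff hlt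
    exact Finset.mem_image.2 ⟨f, by simpa [hd] using hf, rfl⟩

/-- In one step from an unstable matching, the expected weight essentially does not increase. -/
lemma IsAttractive.sum_mul_weight_le {A : Market F W} {e : F ≃ W} {z : F} {m N : ℕ} {κ : ℝ}
    (hκ : 0 ≤ κ) (hA : A.IsAttractive e z m) (hm : N + 9 + 254 * κ * (N + 9) < m)
    {B : F → W → Prop} {μ : Matching F W}
    (hB : ∀ f w, B f w → A.IsBlocking μ f w) (hB' : ∀ f w, A.IsBestBlocking μ f w → B f w)
    {q : Matching F W → ℝ} (hq : ∀ ν, 0 ≤ q ν)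
    (hstep : ∀ ν, q ν ≠ 0 → ∃ f w, B f w ∧ ν = μ.satisfy f w)
    (hratio : ∀ f w f' w', B f w → B f' w' → q (μ.satisfy f w) ≤ κ * q (μ.satisfy f' w')) :
    ∑ ν, q ν * weight e z ν ≤ (weight e z μ + 64 * (1 / 2) ^ N) * ∑ ν, q ν := by
  classical
  have hpow : (0 : ℝ) ≤ 64 * (1 / 2) ^ N := by positivity
  have hwμ := weight_pos e z μ
  rw [Finset.mul_sum]
  by_cases hμ : IsNearPerfect e z μ
  · refine Finset.sum_le_sum fun ν _ => ?_
    rw [mul_comm]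
    rcases eq_or_ne (q ν) 0 with h0 | h0
    · simp [h0]
    · obtain ⟨f, w, hfw, rfl⟩ := hstep ν h0
      have := weight_satisfy_le_of_isNearPerfect hμ (hB f w hfw).1
      exact mul_le_mul_of_nonneg_right (by linarith) (hq _)
  -- Far from `e` no drift is needed: the error term alone bounds any weight after one step.
  by_cases hN : N < μ.distance e
  · refine Finset.sum_le_sum fun ν _ => ?_
    rw [mul_comm]
    rcases eq_or_ne (q ν) 0 with h0 | h0
    · simp [h0]
    · obtain ⟨f, w, hfw, rfl⟩ := hstep ν h0
      have h1 : N ≤ (μ.satisfy f w).distance e := by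
        have := distance_le_satisfy (e := e) (μ := μ) f w
        omega
      have := weight_le e z h1
      exact mul_le_mul_of_nonneg_right (by linarith) (hq _)
  rw [not_lt] at hN
  obtain ⟨U, hU, hUw⟩ := hA.exists_matchings hμ
  obtain ⟨s, hs, hsw⟩ := exists_pairs_weight_le e z μ
  -- `D` contains the few steps that may raise the weight, `U` the many that at least halve it.
  set D : Finset (Matching F W) :=
    (s.filter fun p => B p.1 p.2).image fun p => μ.satisfy p.1 p.2 with hD
  have hDcard : D.card ≤ N + 9 := by
    refine Finset.card_image_le.trans ((Finset.card_filter_le _ _).trans ?_)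
    omega
  -- The weight grows at most by the factor `128 = 2 * 4 ^ 3`, an excess of 127 on `D`; each step in
  -- `U` saves at least one half. Hence `254 = 2 * 127` in `hm`.
  have hpoint : ∀ ν, q ν * weight e z ν ≤ weight e z μ *
      (q ν + (127 * (if ν ∈ D then q ν else 0) - (if ν ∈ U then q ν else 0) / 2)) := by
    intro ν
    rcases eq_or_ne (q ν) 0 with h0 | h0
    · simp [h0]
    obtain ⟨f, w, hfw, rfl⟩ := hstep ν h0
    have hqν := hq (μ.satisfy f w)
    have hw : weight e z (μ.satisfy f w) ≤ 128 * weight e z μ := by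
      have h1 := half_pow_distance_satisfy_le e μ f w
      have h2 : (4 : ℝ) ^ level e z (μ.satisfy f w) ≤ 4 ^ 3 :=
        pow_le_pow_right₀ (by norm_num) (level_le e z _)
      rw [weight_of_not hμ, weight]
      calc _ ≤ (2 * (1 / 2 : ℝ) ^ μ.distance e) * 4 ^ 3 := by gcongr
        _ = _ := by ring
    have hprod := mul_nonneg hqν hwμ.le
    by_cases hνU : μ.satisfy f w ∈ U
    · have h1 := mul_le_mul_of_nonneg_left (hUw _ hνU).2 hqν
      rw [if_pos hνU]
      split_ifs <;> nlinarith
    · rw [if_neg hνU]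
      split_ifs with hνD
      · nlinarith [mul_le_mul_of_nonneg_left hw hqν]
      · have h1 : (f, w) ∉ s := fun h => hνD
          (Finset.mem_image.2 ⟨(f, w), Finset.mem_filter.2 ⟨h, hfw⟩, rfl⟩)
        have := hsw f w (hB f w hfw).1 hμ h1
        nlinarith [mul_le_mul_of_nonneg_left this hqν]
  have hUcard : 254 * κ * (N + 9) < U.card := by
    have : (m : ℝ) ≤ U.card + N + 9 := by exact_mod_cast hU.trans (by omega)
    linarith
  -- The ratio bound is summed over `D × U`.
  have hcross : U.card * ∑ ν ∈ D, q ν ≤ κ * D.card * ∑ ν ∈ U, q ν := by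
    have : ∑ ν ∈ D, ∑ ν' ∈ U, q ν ≤ ∑ ν ∈ D, ∑ ν' ∈ U, κ * q ν' := by
      refine Finset.sum_le_sum fun ν hν => Finset.sum_le_sum fun ν' hν' => ?_
      obtain ⟨p, hp, rfl⟩ := Finset.mem_image.1 hν
      obtain ⟨f', w', hb, rfl⟩ := (hUw ν' hν').1
      exact hratio _ _ _ _ (Finset.mem_filter.1 hp).2 (hB' _ _ hb)
    simp only [Finset.sum_const, nsmul_eq_mul, ← Finset.mul_sum] at this
    linarith
  have hSU : 0 ≤ ∑ ν ∈ U, q ν := Finset.sum_nonneg fun ν _ => hq ν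
  have hfinal : 127 * ∑ ν ∈ D, q ν ≤ (∑ ν ∈ U, q ν) / 2 := by
    have hUpos : (0 : ℝ) < U.card := lt_of_le_of_lt (by positivity) hUcard
    refine le_of_mul_le_mul_left ?_ hUpos
    have h1 : κ * D.card ≤ κ * (N + 9) :=
      mul_le_mul_of_nonneg_left (by exact_mod_cast hDcard) hκ
    have h2 : κ * D.card * ∑ ν ∈ U, q ν ≤ U.card / 254 * ∑ ν ∈ U, q ν :=
      mul_le_mul_of_nonneg_right (by linarith) hSU
    linarith
  calc ∑ ν, q ν * weight e z ν
      ≤ ∑ ν, weight e z μ *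
        (q ν + (127 * (if ν ∈ D then q ν else 0) - (if ν ∈ U then q ν else 0) / 2)) :=
        Finset.sum_le_sum fun ν _ => hpoint ν
    _ = weight e z μ * (∑ ν, q ν + (127 * ∑ ν ∈ D, q ν - (∑ ν ∈ U, q ν) / 2)) := by
        rw [← Finset.mul_sum, Finset.sum_add_distrib, Finset.sum_sub_distrib, ← Finset.mul_sum,
          ← Finset.sum_div]
        simp
    _ ≤ weight e z μ * ∑ ν, q ν := mul_le_mul_of_nonneg_left (by linarith) hwμ.le
    _ ≤ (weight e z μ + 64 * (1 / 2) ^ N) * ∑ ν, q ν :=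
        mul_le_mul_of_nonneg_right (by linarith) (Finset.sum_nonneg fun ν _ => hq ν)
    _ = _ := by rw [Finset.mul_sum]

end Market

/-! ### From the drift to the hitting time. -/

namespace Market

open MeasureTheory Matching

variable {F W : Type*} [DecidableEq F] [DecidableEq W]
  {M : Market F W} {B : Matching F W → F → W → Prop} {κ : ℝ} {lam : Matching F W}
  {Ω : Type*} [MeasurableSpace Ω] {P : Measure Ω} {X : ℕ → Ω → Matching F W}

namespace IsKappaRandom

lemma measureReal_step_ratio [IsFiniteMeasure P] (hκ : 0 ≤ κ) (hX : M.IsKappaRandom B κ lam P X)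
    (t : ℕ) (μ : Matching F W) (f : F) (w : W) (f' : F) (w' : W) (h : B μ f w) (h' : B μ f' w') :
    P.real {ω | X t ω = μ ∧ X (t + 1) ω = μ.satisfy f w} ≤
      κ * P.real {ω | X t ω = μ ∧ X (t + 1) ω = μ.satisfy f' w'} := by
  have := ENNReal.toReal_mono (ENNReal.mul_ne_top ENNReal.ofReal_ne_top (measure_ne_top P _))
    (hX.ratio t μ f w f' w' h h')
  rwa [ENNReal.toReal_mul, ENNReal.toReal_ofReal hκ] at this

lemma exists_of_measureReal_step_ne_zero (hX : M.IsKappaRandom B κ lam P X) {t : ℕ}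
    {μ ν : Matching F W} (hμ : ¬ M.IsStable μ)
    (h : P.real {ω | X t ω = μ ∧ X (t + 1) ω = ν} ≠ 0) : ∃ f w, B μ f w ∧ ν = μ.satisfy f w := by
  contrapose! h
  have : P {ω | X t ω = μ ∧ X (t + 1) ω = ν} = 0 := by
    refine measure_mono_null ?_ (hX.step_unstable t)
    rintro ω ⟨rfl, rfl⟩ h1
    obtain ⟨f, w, hB, h2⟩ := h1 hμ
    exact h f w hB h2
  simp [Measure.real, this]

lemma eq_of_measureReal_step_ne_zero (hX : M.IsKappaRandom B κ lam P X) {t : ℕ}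
    {μ ν : Matching F W} (hμ : M.IsStable μ)
    (h : P.real {ω | X t ω = μ ∧ X (t + 1) ω = ν} ≠ 0) : ν = μ := by
  contrapose! h
  have : P {ω | X t ω = μ ∧ X (t + 1) ω = ν} = 0 := by
    refine measure_mono_null ?_ (hX.step_stable t)
    rintro ω ⟨rfl, rfl⟩ h1
    exact h (h1 hμ)
  simp [Measure.real, this]

/-- Almost surely, a stable matching is never left. -/
lemma ae_forall_eq_of_isStable (hX : M.IsKappaRandom B κ lam P X) :
    ∀ᵐ ω ∂P, ∀ t s, t ≤ s → M.IsStable (X t ω) → X s ω = X t ω := by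
  filter_upwards [ae_all_iff.2 hX.step_stable] with ω hω t s hts ht
  induction s, hts using Nat.le_induction with
  | base => rfl
  | succ s _ ih => rw [hω s (by rwa [ih]), ih]

variable [Fintype F] [Fintype W]

/-- Total probability, applied to `P` restricted to `S`; only the events of `X t` need to be
measurable. -/
lemma sum_measureReal_and [IsFiniteMeasure P] (hX : M.IsKappaRandom B κ lam P X) (t : ℕ)
    (S : Ω → Prop) :
    ∑ ν, P.real {ω | S ω ∧ X t ω = ν} = P.real {ω | S ω} := by
  have h := sum_measureReal_preimage_singleton (μ := P.restrict {ω | S ω}) Finset.univ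
    (f := X t) fun ν _ => hX.measurable t ν
  simp only [Finset.coe_univ, Set.preimage_univ, measureReal_restrict_apply_univ] at h
  rw [← h]
  refine Finset.sum_congr rfl fun ν _ => ?_
  rw [Set.ofPred_and, Set.inter_comm]
  exact (measureReal_restrict_apply (hX.measurable t ν)).symm

lemma sum_measureReal_step [IsFiniteMeasure P] (hX : M.IsKappaRandom B κ lam P X) (t : ℕ)
    (μ : Matching F W) :
    ∑ ν, P.real {ω | X t ω = μ ∧ X (t + 1) ω = ν} = P.real {ω | X t ω = μ} :=
  hX.sum_measureReal_and (t + 1) fun ω => X t ω = μ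

lemma sum_measureReal_step' [IsFiniteMeasure P] (hX : M.IsKappaRandom B κ lam P X) (t : ℕ)
    (ν : Matching F W) :
    ∑ μ, P.real {ω | X t ω = μ ∧ X (t + 1) ω = ν} = P.real {ω | X (t + 1) ω = ν} := by
  rw [← hX.sum_measureReal_and t fun ω => X (t + 1) ω = ν]
  simp only [and_comm]

variable {e : F ≃ W} {z : F} {m N : ℕ}

/-- The one-step bound is summed over the current matching; as the total mass is 1, each step adds
at most `64 * (1 / 2) ^ N`. -/
lemma sum_weight_le [IsProbabilityMeasure P] (hX : M.IsKappaRandom B κ lam P X) (hκ : 0 ≤ κ)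
    (hM : M.IsAttractive e z m) (hm : N + 9 + 254 * κ * (N + 9) < m)
    (hB : ∀ μ f w, B μ f w → M.IsBlocking μ f w)
    (hB' : ∀ μ f w, M.IsBestBlocking μ f w → B μ f w) (hlam : N ≤ lam.distance e) (t : ℕ) :
    ∑ ν, P.real {ω | X t ω = ν} * weight e z ν ≤ 64 * (t + 1) * (1 / 2) ^ N := by
  have hpow : (0 : ℝ) ≤ 64 * (1 / 2) ^ N := by positivity
  have htotal : ∀ t, ∑ ν, P.real {ω | X t ω = ν} = 1 := fun t => by
    simpa using hX.sum_measureReal_and t fun _ => True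
  induction t with
  | zero =>
    have hzero : ∀ ν, ν ≠ lam → P.real {ω | X 0 ω = ν} = 0 := fun ν hν => by
      have : P {ω | X 0 ω = ν} = 0 := by
        refine measure_mono_null ?_ hX.start
        rintro ω rfl h
        exact hν h
      simp [Measure.real, this]
    have h1 := htotal 0
    rw [Finset.sum_eq_single lam (fun ν _ hν => hzero ν hν) (by simp)] at h1
    rw [Finset.sum_eq_single lam (fun ν _ hν => by rw [hzero ν hν, zero_mul]) (by simp), h1]
    simpa using weight_le e z hlam
  | succ t ih =>
    have hstep : ∀ μ, ∑ ν, P.real {ω | X t ω = μ ∧ X (t + 1) ω = ν} * weight e z ν ≤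
        (weight e z μ + 64 * (1 / 2) ^ N) * P.real {ω | X t ω = μ} := by
      intro μ
      rw [← hX.sum_measureReal_step t μ]
      by_cases hμ : M.IsStable μ
      · rw [Finset.mul_sum]
        refine Finset.sum_le_sum fun ν _ => ?_
        by_cases h : P.real {ω | X t ω = μ ∧ X (t + 1) ω = ν} = 0
        · simp [h]
        · rw [hX.eq_of_measureReal_step_ne_zero hμ h, mul_comm]
          exact mul_le_mul_of_nonneg_right (by linarith) measureReal_nonneg
      · exact hM.sum_mul_weight_le hκ hm (hB μ) (hB' μ) (fun _ => measureReal_nonneg)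
          (fun ν h => hX.exists_of_measureReal_step_ne_zero hμ h)
          (hX.measureReal_step_ratio hκ t μ)
    calc ∑ ν, P.real {ω | X (t + 1) ω = ν} * weight e z ν
        = ∑ μ, ∑ ν, P.real {ω | X t ω = μ ∧ X (t + 1) ω = ν} * weight e z ν := by
          rw [Finset.sum_comm]
          simp only [← Finset.sum_mul, hX.sum_measureReal_step']
      _ ≤ ∑ μ, (weight e z μ + 64 * (1 / 2) ^ N) * P.real {ω | X t ω = μ} :=
          Finset.sum_le_sum fun μ _ => hstep μ
      _ = ∑ μ, P.real {ω | X t ω = μ} * weight e z μ + 64 * (1 / 2) ^ N := by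
          simp only [add_mul, Finset.sum_add_distrib, ← Finset.mul_sum, htotal, mul_one]
          simp only [mul_comm]
      _ ≤ _ := by
          push_cast
          linarith

/-- The process is unlikely to be at the stable matching `e` after less than `2 ^ N` steps. -/
lemma measureReal_eq_stable_le [IsProbabilityMeasure P] (hX : M.IsKappaRandom B κ lam P X)
    (hκ : 0 ≤ κ) (hM : M.IsAttractive e z m) (hm : N + 9 + 254 * κ * (N + 9) < m)
    (hB : ∀ μ f w, B μ f w → M.IsBlocking μ f w)
    (hB' : ∀ μ f w, M.IsBestBlocking μ f w → B μ f w) (hlam : N ≤ lam.distance e) (t : ℕ) :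
    P.real {ω | X t ω = e.toPEquiv} ≤ 64 * (t + 1) * (1 / 2) ^ N := by
  have hw : 1 ≤ weight e z e.toPEquiv := by
    have : distance e e.toPEquiv = 0 := by simp [distance]
    rw [weight, this, pow_zero, one_mul]
    exact one_le_pow₀ (by norm_num)
  calc P.real {ω | X t ω = e.toPEquiv}
      ≤ P.real {ω | X t ω = e.toPEquiv} * weight e z e.toPEquiv :=
        le_mul_of_one_le_right measureReal_nonneg hw
    _ ≤ ∑ ν, P.real {ω | X t ω = ν} * weight e z ν :=
        Finset.single_le_sum (f := fun ν => P.real {ω | X t ω = ν} * weight e z ν)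
          (fun ν _ => mul_nonneg measureReal_nonneg (weight_pos e z ν).le) (Finset.mem_univ _)
    _ ≤ _ := hX.sum_weight_le hκ hM hm hB hB' hlam t

/-- Since stable matchings are absorbing, stopping before `T` puts the process at `e` at the single
time `⌈T⌉₊`, so no union bound over times is needed. -/
lemma le_measureReal_forall_isStable [IsProbabilityMeasure P] (hX : M.IsKappaRandom B κ lam P X)
    (hκ : 0 ≤ κ) (hM : M.IsAttractive e z m) (hm : N + 9 + 254 * κ * (N + 9) < m)
    (hB : ∀ μ f w, B μ f w → M.IsBlocking μ f w)
    (hB' : ∀ μ f w, M.IsBestBlocking μ f w → B μ f w) (hlam : N ≤ lam.distance e)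
    (he : ∀ μ, M.IsStable μ → μ = e.toPEquiv) (T : ℝ) :
    1 - 64 * (⌈T⌉₊ + 1) * (1 / 2) ^ N ≤
      P.real {ω | ∀ t : ℕ, M.IsStable (X t ω) → T ≤ t} := by
  set S := {ω | ∀ t : ℕ, M.IsStable (X t ω) → T ≤ t} with hS
  have h1 : P.real Sᶜ ≤ P.real {ω | X ⌈T⌉₊ ω = e.toPEquiv} := by
    refine ENNReal.toReal_mono (measure_ne_top P _) (measure_mono_ae ?_)
    filter_upwards [hX.ae_forall_eq_of_isStable] with ω hω hωS
    have hωS : ¬ ∀ t : ℕ, M.IsStable (X t ω) → T ≤ t := hωS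
    push Not at hωS
    obtain ⟨t, ht, htT⟩ := hωS
    have hle : t ≤ ⌈T⌉₊ := by exact_mod_cast (htT.le.trans (Nat.le_ceil T))
    exact (hω t _ hle ht).trans (he _ ht)
  have h2 := hX.measureReal_eq_stable_le hκ hM hm hB hB' hlam ⌈T⌉₊
  -- Subadditivity suffices, so measurability of `S` is not needed.
  have h3 := measureReal_union_le (μ := P) S Sᶜ
  rw [Set.union_compl_self, probReal_univ] at h3
  linarith

end IsKappaRandom

end Market

/-! ### Application to the augmented market and choice of constants. -/

namespace Market

open MeasureTheory Matching

lemma augment_isAttractive {n k m : ℕ} {M : Market (Fin n) (Fin n)} {e : Fin n ≃ Fin n}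
    (hk : k = 2 * m + 3) {z : Fin k} (hz : (z : ℕ) = 0) :
    (M.augment k e).IsAttractive (augEquiv k e) (.inr z) m where
  firm := augment_exists_workers hk hz
  worker := augment_exists_firms hk hz

/-- The bound on the hitting time, for the dynamics on an augmented market. -/
lemma augment_le_measureReal {n k m N : ℕ} {M : Market (Fin n) (Fin n)} {e : Fin n ≃ Fin n}
    (hM : ∃! μ, M.IsStable μ) (he : M.IsStable e.toPEquiv) (hk : k = 2 * m + 3) {κ ε : ℝ}
    (hκ : 0 ≤ κ) (hm : N + 9 + 254 * κ * (N + 9) < m) (hN : N ≤ ε * (n + k))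
    {lam : Matching (Fin n ⊕ Fin k) (Fin n ⊕ Fin k)} (hlam : (M.augment k e).IsEpsUnstable ε lam)
    {Ω : Type*} [MeasurableSpace Ω] {P : Measure Ω} [IsProbabilityMeasure P]
    {X : ℕ → Ω → Matching (Fin n ⊕ Fin k) (Fin n ⊕ Fin k)}
    (hX : (M.augment k e).IsRandomDynamics κ lam P X ∨
      (M.augment k e).IsRandomBestDynamics κ lam P X) (T : ℝ) :
    1 - 64 * (⌈T⌉₊ + 1) * (1 / 2) ^ N ≤
      P.real {ω | ∀ t : ℕ, (M.augment k e).IsStable (X t ω) → T ≤ t} := by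
  have huniq : ∀ μ, (M.augment k e).IsStable μ → μ = (augEquiv k e).toPEquiv := fun μ hμ =>
    (augment_existsUnique hM he).unique hμ (augment_isStable he)
  have hA := augment_isAttractive (M := M) (e := e) hk (z := ⟨0, by omega⟩) rfl
  have hd : N ≤ lam.distance (augEquiv k e) := by
    obtain ⟨μ, hμ, h⟩ := hlam
    have hcard : ({f | lam f ≠ μ f} : Set (Fin n ⊕ Fin k)).ncard =
        lam.distance (augEquiv k e) := by
      rw [huniq μ hμ, distance, ← Set.ncard_coe_finset]
      simp
    rw [hcard] at h
    simp only [Fintype.card_sum, Fintype.card_fin, Nat.cast_add] at h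
    exact_mod_cast hN.trans h
  rcases hX with hX | hX
  · exact IsKappaRandom.le_measureReal_forall_isStable hX hκ hA hm (fun _ _ _ h => h)
      (fun _ _ _ h => h.1) hd huniq T
  · exact IsKappaRandom.le_measureReal_forall_isStable hX hκ hA hm (fun _ _ _ h => h.1)
      (fun _ _ _ h => h) hd huniq T

end Market

/-- With `y = c * x`, the product of `2 ^ y` and `(1 / 2) ^ N` is at most `2 * 2 ^ (-3 * y)`; the
spare factor `2 ^ (2 * y) ≥ 512` absorbs the constants. -/
lemma ceil_rpow_mul_half_pow_le {c x : ℝ} {N : ℕ} (hcx : 9 / 2 ≤ c * x) (hN : 4 * (c * x) ≤ N + 1) :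
    64 * (⌈(2 : ℝ) ^ (c * x)⌉₊ + 1) * (1 / 2 : ℝ) ^ N ≤ (2 : ℝ) ^ (-(c * x)) := by
  set y := c * x
  have hT : (1 : ℝ) ≤ 2 ^ y := Real.one_le_rpow (by norm_num) (by linarith)
  have h1 : (⌈(2 : ℝ) ^ y⌉₊ : ℝ) + 1 ≤ 3 * 2 ^ y := by
    have := Nat.ceil_lt_add_one (zero_le_one.trans hT)
    linarith
  have h2 : (1 / 2 : ℝ) ^ N ≤ 2 ^ (1 - 4 * y) := by
    rw [one_div, inv_pow, ← Real.rpow_natCast, ← Real.rpow_neg (by norm_num)]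
    exact Real.rpow_le_rpow_of_exponent_le (by norm_num) (by linarith)
  have h3 : (512 : ℝ) ≤ 2 ^ (2 * y) := by
    calc (512 : ℝ) = 2 ^ (9 : ℝ) := by norm_num
      _ ≤ _ := Real.rpow_le_rpow_of_exponent_le (by norm_num) (by linarith)
  have h4 : (2 : ℝ) ^ (1 - 4 * y) * 2 ^ y * 2 ^ (2 * y) = 2 * 2 ^ (-y) := by
    rw [← Real.rpow_add (by norm_num), ← Real.rpow_add (by norm_num)]
    rw [show 1 - 4 * y + y + 2 * y = 1 + -y by ring, Real.rpow_add (by norm_num), Real.rpow_one]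
  calc 64 * (⌈(2 : ℝ) ^ y⌉₊ + 1) * (1 / 2 : ℝ) ^ N
      ≤ 64 * (3 * 2 ^ y) * 2 ^ (1 - 4 * y) := by gcongr
    _ = 192 * (2 ^ (1 - 4 * y) * 2 ^ y) := by ring
    _ ≤ 2 ^ (2 * y) / 2 * (2 ^ (1 - 4 * y) * 2 ^ y) := by
        gcongr
        linarith
    _ = (2 ^ (1 - 4 * y) * 2 ^ y * 2 ^ (2 * y)) / 2 := by ring
    _ = 2 ^ (-y) := by rw [h4]; ring

/-- The integer `k n` is the number of new firms, and of new workers, in the augmented market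
`A n`. The constant `c` does not depend on the starting matchings and the processes. -/
theorem theorem2
    (M : (n : ℕ) → Market (Fin n) (Fin n))
    (hM : ∀ n, ∃! μ, (M n).IsStable μ)
    (δ ε κ : ℝ) (hδ : 0 < δ) (hε : 0 < ε) (hε1 : ε ≤ 1) (hκ : 1 ≤ κ) :
    ∃ (k : ℕ → ℕ) (A : (n : ℕ) → Market (Fin n ⊕ Fin (k n)) (Fin n ⊕ Fin (k n))),
      (∀ n, (M n).IsAugmentation δ (A n)) ∧
      ∃ c : ℝ, 0 < c ∧ ∀ᶠ n : ℕ in Filter.atTop,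
        ∀ lam : Matching (Fin n ⊕ Fin (k n)) (Fin n ⊕ Fin (k n)), (A n).IsEpsUnstable ε lam →
          ∀ (Ω : Type*) [MeasurableSpace Ω] (P : MeasureTheory.Measure Ω)
            [MeasureTheory.IsProbabilityMeasure P]
            (X : ℕ → Ω → Matching (Fin n ⊕ Fin (k n)) (Fin n ⊕ Fin (k n))),
            ((A n).IsRandomDynamics κ lam P X ∨ (A n).IsRandomBestDynamics κ lam P X) →
              1 - (2 : ℝ) ^ (-(c * n)) ≤
                P.real {ω | ∀ t : ℕ, (A n).IsStable (X t ω) → (2 : ℝ) ^ (c * n) ≤ t} := by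
  have hequiv : ∀ n, ∃ e : Fin n ≃ Fin n, (M n).IsStable e.toPEquiv := fun n => by
    obtain ⟨μ, hμ, -⟩ := hM n
    obtain ⟨e, rfl⟩ := hμ.exists_eq_toPEquiv (Equiv.refl _)
    exact ⟨e, hμ⟩
  choose e he using hequiv
  -- The threshold is where `2 * (δ * n / 3) + 3 ≤ δ * n` begins to hold; below it nothing is added,
  -- as the size bound is required for every `n`.
  set k : ℕ → ℕ := fun n => if 9 ≤ δ * n then 2 * ⌊δ * n / 3⌋₊ + 3 else 0 with hk
  set C : ℝ := 1 + 254 * κ with hC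
  have hCpos : 0 < C := by positivity
  -- With `N = ⌊β * n⌋₊`, the bound by `ε` puts the initial distance above `N`, and the other bound
  -- gives `C * N ≤ δ * n / 12`, well below `m = ⌊δ * n / 3⌋₊` for large `n`.
  set β : ℝ := min ε (δ / (12 * C)) with hβ
  have hβpos : 0 < β := lt_min hε (by positivity)
  have hβC : β * C ≤ δ / 12 := by
    calc β * C ≤ δ / (12 * C) * C := mul_le_mul_of_nonneg_right (min_le_right _ _) hCpos.le
      _ = δ / 12 := by field_simp
  refine ⟨k, fun n => (M n).augment (k n) (e n), fun n =>
    Market.augment_isAugmentation (hM n) (he n) ?_, β / 4, by positivity, ?_⟩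
  · simp only [hk]
    split_ifs with h
    · have := Nat.floor_le (show 0 ≤ δ * n / 3 by positivity)
      push_cast
      linarith
    · simp only [Nat.cast_zero]
      positivity
  have hlarge : ∀ᶠ n : ℕ in Filter.atTop, 9 / δ ≤ n ∧ (4 * (9 * C + 2)) / δ ≤ n ∧ 18 / β ≤ n := by
    have := tendsto_natCast_atTop_atTop (R := ℝ)
    exact (this.eventually_ge_atTop _).and
      ((this.eventually_ge_atTop _).and (this.eventually_ge_atTop _))
  filter_upwards [hlarge] with n ⟨h1, h2, h3⟩ lam hlam Ω _ P _ X hX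
  rw [div_le_iff₀' hδ] at h1 h2
  rw [div_le_iff₀' hβpos] at h3
  have hkn : k n = 2 * ⌊δ * n / 3⌋₊ + 3 := if_pos h1
  have hβn : 0 ≤ β * n := by positivity
  have hNle := Nat.floor_le hβn
  have hNlt := Nat.lt_floor_add_one (β * n)
  have hmlt := Nat.lt_floor_add_one (δ * n / 3)
  have hm : (⌊β * n⌋₊ : ℝ) + 9 + 254 * κ * (⌊β * n⌋₊ + 9) < ⌊δ * n / 3⌋₊ := by
    have h4 : C * ⌊β * n⌋₊ ≤ δ / 12 * n := by
      calc C * (⌊β * n⌋₊ : ℝ) ≤ C * (β * n) := mul_le_mul_of_nonneg_left hNle hCpos.le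
        _ = β * C * n := by ring
        _ ≤ _ := mul_le_mul_of_nonneg_right hβC n.cast_nonneg
    have h5 : (⌊β * n⌋₊ : ℝ) + 9 + 254 * κ * (⌊β * n⌋₊ + 9) = C * ⌊β * n⌋₊ + 9 * C := by
      rw [hC]
      ring
    rw [h5]
    linarith
  have hN : (⌊β * n⌋₊ : ℝ) ≤ ε * (n + k n) := by
    calc (⌊β * n⌋₊ : ℝ) ≤ β * n := hNle
      _ ≤ ε * (n + k n) := mul_le_mul (min_le_left _ _) (by simp) n.cast_nonneg hε.le
  have hfin := Market.augment_le_measureReal (hM n) (he n) hkn (by linarith) hm hN hlam hX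
    ((2 : ℝ) ^ (β / 4 * n))
  have hexp := ceil_rpow_mul_half_pow_le (c := β / 4) (x := n) (N := ⌊β * n⌋₊)
    (by linarith) (by linarith)
  linarith
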